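/- A tree is a set $T\subseteq\mathbb N^{<\mathbb N}$ of finite sequences closed under initial segments. It is well-founded if it has no infinite path, and a leaf of $T$ is an element of $T$ with no proper extension in $T$. A subtree $S\subseteq T$ is perfect if every $\sigma\in S$ has two incompatible extensions in $S$, and the perfect kernel of $T$ is the union of all perfect subtrees of $T$. Sets of finite sequences are represented by their characteristic functions (through a standard coding of $\mathbb N^{<\mathbb N}$ by $\mathbb N$); numbers, pairs and sequences of represented objects are represented in the usual way. For problems (partial multivalued functions between represented spaces) $f,g$, one writes $f\le_{\mathrm{sW}}g$ if there are computable $H,K:\subseteq\mathbb N^{\mathbb N}\to\mathbb N^{\mathbb N}$ such that $H\circ G\circ K$ is a realizer of $f$ for every realizer $G$ of $g$, and $f\equiv_{\mathrm{sW}}g$ if $f\le_{\mathrm{sW}}g$ and $g\le_{\mathrm{sW}}f$. The parallelization $\widehat f$ takes a sequence $(x_i)_{i\in\mathbb N}$ of instances of $f$ to the sequences $(y_i)_{i\in\mathbb N}$ with $y_i\in f(x_i)$ for all $i$. Let $\mathsf{WF}$ be the problem that takes a tree $T$ and outputs $1$ if $T$ is well-founded and $0$ otherwise, and let $\mathsf{PK}$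 be the problem that takes a tree and outputs its perfect kernel. Let $\mathsf{WF}_L$ and $\mathsf{PK}_L$ be the same problems with input a pair consisting of a tree and its set of leaves. Let $\widehat{\mathsf{WF}}$ and $\widehat{\mathsf{WF}}_L$ be the parallelizations of $\mathsf{WF}$ and $\mathsf{WF}_L$. Theorem. $\mathsf{WF}\equiv_{\mathrm{sW}}\mathsf{WF}_L$. Moreover, the four problems $\widehat{\mathsf{WF}}$, $\widehat{\mathsf{WF}}_L$, $\mathsf{PK}$ and $\mathsf{PK}_L$ are pairwise strongly Weihrauch equivalent. -/

import Mathlib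

namespace TreeWeihrauch

/-! ### Computable functionals on Baire space -/

/-- Partial recursive functionals `(p, n) ↦ Φ p n` with a total oracle `p : ℕ → ℕ`: the least class
that contains zero, successor, the projections and the query of the oracle, and that is closed,
uniformly in the oracle, under pairing, composition, primitive recursion and minimization. -/
inductive RecFunctional : ((ℕ → ℕ) → ℕ →. ℕ) → Prop
  | zero : RecFunctional fun _ _ => Part.some 0
  | succ : RecFunctional fun _ n => Part.some (n + 1)
  | left : RecFunctional fun _ n => Part.some (Nat.unpair n).1
  | right : RecFunctional fun _ n => Part.some (Nat.unpair n).2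
  | oracle : RecFunctional fun p n => Part.some (p n)
  | pair {Φ Ψ : (ℕ → ℕ) → ℕ →. ℕ} (hΦ : RecFunctional Φ) (hΨ : RecFunctional Ψ) :
      RecFunctional fun p n => Nat.pair <$> Φ p n <*> Ψ p n
  | comp {Φ Ψ : (ℕ → ℕ) → ℕ →. ℕ} (hΦ : RecFunctional Φ) (hΨ : RecFunctional Ψ) :
      RecFunctional fun p n => Ψ p n >>= Φ p
  | prec {Φ Ψ : (ℕ → ℕ) → ℕ →. ℕ} (hΦ : RecFunctional Φ) (hΨ : RecFunctional Ψ) :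
      RecFunctional fun p m =>
        let (a, n) := Nat.unpair m
        n.rec (Φ p a) fun y IH => do
          let i ← IH
          Ψ p (Nat.pair a (Nat.pair y i))
  | rfind {Φ : (ℕ → ℕ) → ℕ →. ℕ} (hΦ : RecFunctional Φ) :
      RecFunctional fun p a =>
        Nat.rfind fun n => (fun m => decide (m = 0)) <$> Φ p (Nat.pair a n)

/-- A partial function `F` on Baire space is computable if one oracle program computes, for every
`p` in the domain of `F`, all the values of `F p` from the oracle `p`. -/
def IsComputable (F : (ℕ → ℕ) →. (ℕ → ℕ)) : Prop :=
  ∃ Φ, RecFunctional Φ ∧ ∀ p, ∀ q ∈ F p, ∀ n, Φ p n = Part.some (q n)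

/-! ### Represented spaces -/

/-- A represented space: a partial surjection from Baire space onto `X`, given by its graph
`Names`. -/
class Represented (X : Type*) where
  /-- `Names p x`: the point `p` of Baire space is a name of `x`. -/
  Names : (ℕ → ℕ) → X → Prop
  names_unique : ∀ {p x y}, Names p x → Names p y → x = y
  exists_name : ∀ x, ∃ p, Names p x

/-- A natural number is named by the sequences that start with it. -/
instance : Represented ℕ where
  Names p n := p 0 = n
  names_unique h h' := h.symm.trans h'
  exists_name n := ⟨fun _ => n, rfl⟩

/-- A set of finite sequences is named by its characteristic function, through the standard
bijective coding of finite sequences by natural numbers. -/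
instance : Represented (Set (List ℕ)) where
  Names p A := ∀ σ : List ℕ,
    (σ ∈ A → p (Encodable.encode σ) = 1) ∧ (σ ∉ A → p (Encodable.encode σ) = 0)
  names_unique {p A B} hA hB := by
    ext σ
    by_cases h1 : σ ∈ A <;> by_cases h2 : σ ∈ B
    · simp [h1, h2]
    · have := (hA σ).1 h1
      have := (hB σ).2 h2
      omega
    · have := (hA σ).2 h1
      have := (hB σ).1 h2
      omega
    · simp [h1, h2]
  exists_name A := by
    classical
    refine ⟨fun n => if Denumerable.ofNat (List ℕ) n ∈ A then 1 else 0, fun σ => ?_⟩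
    constructor <;> intro h <;> simp [h]

/-- A pair is named by interleaving names of its components. -/
instance {X Y : Type*} [Represented X] [Represented Y] : Represented (X × Y) where
  Names p z := Represented.Names (fun n => p (2 * n)) z.1 ∧
    Represented.Names (fun n => p (2 * n + 1)) z.2
  names_unique h h' :=
    Prod.ext (Represented.names_unique h.1 h'.1) (Represented.names_unique h.2 h'.2)
  exists_name z := by
    obtain ⟨p, hp⟩ := Represented.exists_name z.1
    obtain ⟨q, hq⟩ := Represented.exists_name z.2
    refine ⟨fun n => if n % 2 = 0 then p (n / 2) else q (n / 2), ?_, ?_⟩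
    · convert hp using 2 with n
      simp
    · convert hq using 2 with n
      have h1 : (2 * n + 1) % 2 = 1 := by omega
      have h2 : (2 * n + 1) / 2 = n := by omega
      simp [h1, h2]

/-- A sequence of points is named by a sequence of names, merged by the pairing function. -/
instance {X : Type*} [Represented X] : Represented (ℕ → X) where
  Names p x := ∀ i, Represented.Names (fun n => p (Nat.pair i n)) (x i)
  names_unique h h' := funext fun i => Represented.names_unique (h i) (h' i)
  exists_name x := by
    choose p hp using fun i => Represented.exists_name (x i)
    exact ⟨fun m => p (Nat.unpair m).1 (Nat.unpair m).2, fun i => by simpa using hp i⟩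

/-- A subspace inherits the names of the whole space. -/
instance {X : Type*} [Represented X] (P : X → Prop) : Represented {x // P x} where
  Names p x := Represented.Names p x.1
  names_unique h h' := Subtype.ext (Represented.names_unique h h')
  exists_name x := Represented.exists_name x.1

/-! ### Problems and strong Weihrauch reducibility -/

/-- A problem is a partial multivalued function: `f x` is the set of solutions of `x`, and `x` is
an instance (lies in the domain) if `f x` is nonempty. -/
abbrev Problem (X Y : Type*) := X → Set Y

/-- `G` is a realizer of `f`: it maps every name of an instance to a name of a solution. -/
def Realizes {X Y : Type*} [Represented X] [Represented Y]
    (G : (ℕ → ℕ) →. (ℕ → ℕ)) (f : Problem X Y) : Prop :=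
  ∀ p x, Represented.Names p x → (f x).Nonempty →
    ∃ q ∈ G p, ∃ y ∈ f x, Represented.Names q y

/-- Strong Weihrauch reducibility `f ≤_sW g`. -/
def StrongLE {X Y Z W : Type*} [Represented X] [Represented Y] [Represented Z] [Represented W]
    (f : Problem X Y) (g : Problem Z W) : Prop :=
  ∃ H K : (ℕ → ℕ) →. (ℕ → ℕ), IsComputable H ∧ IsComputable K ∧
    ∀ G, Realizes G g → Realizes (H.comp (G.comp K)) f

/-- Strong Weihrauch equivalence `f ≡_sW g`. -/
def StrongEquiv {X Y Z W : Type*} [Represented X] [Represented Y] [Represented Z] [Represented W]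
    (f : Problem X Y) (g : Problem Z W) : Prop :=
  StrongLE f g ∧ StrongLE g f

/-- The (infinite) parallelization of a problem. -/
def parallelization {X Y : Type*} (f : Problem X Y) : Problem (ℕ → X) (ℕ → Y) :=
  fun x => {y | ∀ i, y i ∈ f (x i)}

/-! ### Trees -/

/-- A tree is a set of finite sequences that is closed under initial segments. -/
def IsTree (T : Set (List ℕ)) : Prop :=
  ∀ σ ∈ T, ∀ τ, τ <+: σ → τ ∈ T

/-- The set of leaves: the elements of `T` without proper extensions in `T`. -/
def leaves (T : Set (List ℕ)) : Set (List ℕ) :=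
  {σ | σ ∈ T ∧ ∀ τ ∈ T, σ <+: τ → τ = σ}

/-- `T` is well-founded: no `f : ℕ → ℕ` has all its initial segments in `T`. -/
def IsWellFounded (T : Set (List ℕ)) : Prop :=
  ¬ ∃ f : ℕ → ℕ, ∀ n, (List.range n).map f ∈ T

/-- Every element of `S` has two incompatible extensions in `S`. -/
def IsPerfect (S : Set (List ℕ)) : Prop :=
  ∀ σ ∈ S, ∃ τ₁ ∈ S, ∃ τ₂ ∈ S, σ <+: τ₁ ∧ σ <+: τ₂ ∧ ¬ τ₁ <+: τ₂ ∧ ¬ τ₂ <+: τ₁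

/-- The perfect kernel: the union of all perfect subtrees of `T`. -/
def perfectKernel (T : Set (List ℕ)) : Set (List ℕ) :=
  ⋃₀ {S | S ⊆ T ∧ IsTree S ∧ IsPerfect S}

/-- The represented space of trees. -/
abbrev Tree := {T : Set (List ℕ) // IsTree T}

/-- The represented space of trees given together with their leaf sets. -/
abbrev LeafTree := {z : Tree × Set (List ℕ) // z.2 = leaves z.1.1}

/-! ### The problems -/

/-- Output `1` if the tree is well-founded and `0` otherwise. -/
def WF : Problem Tree ℕ :=
  fun T => {n | (IsWellFounded T.1 ∧ n = 1) ∨ (¬ IsWellFounded T.1 ∧ n = 0)}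

/-- The restriction of `WF` to trees with leaf sets. -/
def WFL : Problem LeafTree ℕ :=
  fun z => WF z.1.1

/-- Find the perfect kernel of a tree. -/
def PK : Problem Tree (Set (List ℕ)) :=
  fun T => {perfectKernel T.1}

/-- The restriction of `PK` to trees with leaf sets. -/
def PKL : Problem LeafTree (Set (List ℕ)) :=
  fun z => PK z.1.1

end TreeWeihrauch

/-!
Increase the entries of a tree `T` by one and add a leaf `σ ⌢ 0` above every node `σ`. This changes
neither the infinite paths nor the perfect subtrees, and the leaves of the new tree can be computed
from `T`; hence leaf sets do not help, and parallelization is monotone.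

To decide the well-foundedness of trees `T i` by one perfect kernel, replace `T i` by
`T i × ℕ^{<ℕ}`, in which a path of `T i` becomes a perfect subtree, and join these trees above the
nodes `[i]`. Conversely, `σ` lies in the perfect kernel of `T` iff the full binary tree can be
mapped into `T` such that the root goes to `σ` and siblings go to incompatible extensions of the
image of their parent. The finite approximations to such a map form a tree that is computable from
`T` and `σ`, and this tree is ill-founded iff the map exists.
-/

namespace TreeWeihrauch

/-! ### Recursive functionals -/

theorem RecFunctional.of_eq {Φ Ψ : (ℕ → ℕ) → ℕ →. ℕ} (hΦ : RecFunctional Φ)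
    (h : ∀ p n, Φ p n = Ψ p n) : RecFunctional Ψ :=
  (funext₂ h : Φ = Ψ) ▸ hΦ

theorem RecFunctional.of_natPrimrec {f : ℕ → ℕ} (hf : Nat.Primrec f) :
    RecFunctional fun _ n => Part.some (f n) := by
  induction hf with
  | zero => exact .zero
  | succ => exact .succ
  | left => exact .left
  | right => exact .right
  | pair _ _ ihf ihg => exact (ihf.pair ihg).of_eq fun _ _ => by simp [Seq.seq]
  | comp _ _ ihf ihg => exact (ihf.comp ihg).of_eq fun _ _ => Part.bind_some _ _
  | @prec f g _ _ ihf ihg =>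
    refine (ihf.prec ihg).of_eq fun _ n => ?_
    simp only [Nat.unpaired]
    induction n.unpair.2 with
    | zero => rfl
    | succ k ih => simp only [ih]; simp

theorem RecFunctional.comp_primrec {Φ : (ℕ → ℕ) → ℕ →. ℕ} (hΦ : RecFunctional Φ) {f : ℕ → ℕ}
    (hf : Primrec f) : RecFunctional fun p n => Φ p (f n) :=
  (hΦ.comp (.of_natPrimrec (Primrec.nat_iff.1 hf))).of_eq fun _ _ => Part.bind_some _ _

theorem RecFunctional.bind {Φ Ψ : (ℕ → ℕ) → ℕ →. ℕ} (hΦ : RecFunctional Φ)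
    (hΨ : RecFunctional Ψ) :
    RecFunctional fun p n => (Φ p n).bind fun k => Ψ p (Nat.pair n k) := by
  refine (hΨ.comp ((of_natPrimrec Nat.Primrec.id).pair hΦ)).of_eq fun p n => ?_
  have hpair : Nat.pair <$> Part.some n <*> Φ p n = (Φ p n).map (Nat.pair n) := by simp [Seq.seq]
  exact (congrArg (Part.bind · (Ψ p)) hpair).trans (Part.bind_map _ _ _)

section

variable {α : Type*} [Primcodable α] {f : α → ℕ}

theorem primrec_unpair_fst (hf : Primrec f) : Primrec fun a => (f a).unpair.1 :=
  Primrec.fst.comp (Primrec.unpair.comp hf)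

theorem primrec_unpair_snd (hf : Primrec f) : Primrec fun a => (f a).unpair.2 :=
  Primrec.snd.comp (Primrec.unpair.comp hf)

end

theorem primrec_pairAssoc :
    Primrec fun m : ℕ => Nat.pair m.unpair.1.unpair.1 (Nat.pair m.unpair.1.unpair.2 m.unpair.2) :=
  have hfst := primrec_unpair_fst Primrec.id
  Primrec₂.natPair.comp (primrec_unpair_fst hfst)
    (Primrec₂.natPair.comp (primrec_unpair_snd hfst) (primrec_unpair_snd Primrec.id))

theorem primrec_pairAssoc_symm :
    Primrec fun m : ℕ => Nat.pair (Nat.pair m.unpair.1 m.unpair.2.unpair.1) m.unpair.2.unpair.2 :=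
  have hsnd := primrec_unpair_snd Primrec.id
  Primrec₂.natPair.comp (Primrec₂.natPair.comp (primrec_unpair_fst Primrec.id)
    (primrec_unpair_fst hsnd)) (primrec_unpair_snd hsnd)

-- The parameter `e` serves two purposes: a dummy in a composition of functionals, and the index of
-- a row in a parallelized functional.
theorem RecFunctional.exists_subst {Φ Ψ : (ℕ → ℕ) → ℕ →. ℕ} (hΦ : RecFunctional Φ)
    (hΨ : RecFunctional Ψ) : ∃ Θ, RecFunctional Θ ∧
      ∀ p e q, (∀ n, Φ p (Nat.pair e n) = Part.some (q n)) → ∀ n, Θ p (Nat.pair e n) = Ψ q n := by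
  have hsnd := primrec_unpair_snd Primrec.id
  induction hΨ with
  | zero => exact ⟨_, .zero, fun _ _ _ _ _ => rfl⟩
  | succ => exact ⟨_, RecFunctional.succ.comp_primrec hsnd, fun _ _ _ _ _ => by simp⟩
  | left => exact ⟨_, RecFunctional.left.comp_primrec hsnd, fun _ _ _ _ _ => by simp⟩
  | right => exact ⟨_, RecFunctional.right.comp_primrec hsnd, fun _ _ _ _ _ => by simp⟩
  | oracle => exact ⟨_, hΦ, fun _ _ _ h => h⟩
  | pair _ _ ih₁ ih₂ =>
    obtain ⟨A, hA, hAΦ⟩ := ih₁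
    obtain ⟨B, hB, hBΨ⟩ := ih₂
    exact ⟨_, hA.pair hB, fun p e q h n => by rw [hAΦ p e q h, hBΨ p e q h]⟩
  | comp _ _ ih₁ ih₂ =>
    obtain ⟨A, hA, hAΦ⟩ := ih₁
    obtain ⟨B, hB, hBΨ⟩ := ih₂
    refine ⟨_, hB.bind (hA.comp_primrec (Primrec₂.natPair.comp
      (primrec_unpair_fst (primrec_unpair_fst Primrec.id)) hsnd)), fun p e q h n => ?_⟩
    simp only [id_eq, Nat.unpair_pair, hAΦ p e q h, hBΨ p e q h]
    rfl
  | prec _ _ ih₁ ih₂ =>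
    obtain ⟨A, hA, hAΦ⟩ := ih₁
    obtain ⟨B, hB, hBΨ⟩ := ih₂
    refine ⟨_, (hA.prec (hB.comp_primrec primrec_pairAssoc)).comp_primrec primrec_pairAssoc_symm,
      fun p e q h m => ?_⟩
    simp only [Nat.unpair_pair, hAΦ p e q h, hBΨ p e q h]
  | rfind _ ih =>
    obtain ⟨A, hA, hAΦ⟩ := ih
    refine ⟨_, (hA.comp_primrec primrec_pairAssoc).rfind, fun p e q h m => ?_⟩
    simp only [Nat.unpair_pair, hAΦ p e q h]

theorem IsComputable.comp {F G : (ℕ → ℕ) →. (ℕ → ℕ)} (hF : IsComputable F)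
    (hG : IsComputable G) : IsComputable (F.comp G) := by
  obtain ⟨Φ, hΦ, hF⟩ := hF
  obtain ⟨Ψ, hΨ, hG⟩ := hG
  obtain ⟨Θ, hΘ, hsubst⟩ := (hΨ.comp_primrec (primrec_unpair_snd Primrec.id)).exists_subst hΦ
  refine ⟨_, hΘ.comp_primrec (Primrec₂.natPair.comp (Primrec.const 0) Primrec.id),
    fun p r hr n => ?_⟩
  obtain ⟨q, hq, hr⟩ := Part.mem_bind_iff.1 hr
  have hpq (n : ℕ) : Ψ p (Nat.pair 0 n).unpair.2 = Part.some (q n) := by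
    rw [Nat.unpair_pair]
    exact hG p q hq n
  exact (hsubst p 0 q hpq n).trans (hF q r hr n)

/-! ### Parallelized functionals -/

/-- The `i`-th of the sequences that the pairing function merges into `p`. -/
def row (p : ℕ → ℕ) (i : ℕ) : ℕ → ℕ := fun n => p (Nat.pair i n)

/-- The partial function on Baire space that applies `F` to every row. -/
def rowwise (F : (ℕ → ℕ) →. (ℕ → ℕ)) : (ℕ → ℕ) →. (ℕ → ℕ) := fun p =>
  ⟨∀ i, (F (row p i)).Dom, fun h m => (F (row p m.unpair.1)).get (h _) m.unpair.2⟩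

theorem row_merge (s : ℕ → ℕ → ℕ) (i : ℕ) :
    row (fun m => s m.unpair.1 m.unpair.2) i = s i :=
  funext fun n => by simp [row]

theorem mem_rowwise_iff {F : (ℕ → ℕ) →. (ℕ → ℕ)} {p r : ℕ → ℕ} :
    r ∈ rowwise F p ↔ ∀ i, row r i ∈ F (row p i) := by
  constructor
  · rintro ⟨h, rfl⟩ i
    refine ⟨h i, ?_⟩
    exact (row_merge (fun i => (F (row p i)).get (h i)) i).symm
  · intro h
    refine ⟨fun i => (h i).1, funext fun m => ?_⟩
    calc (F (row p m.unpair.1)).get _ m.unpair.2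
      _ = row r m.unpair.1 m.unpair.2 := congrFun (h m.unpair.1).2 m.unpair.2
      _ = r m := by rw [row, Nat.pair_unpair]

theorem IsComputable.rowwise {F : (ℕ → ℕ) →. (ℕ → ℕ)} (hF : IsComputable F) :
    IsComputable (rowwise F) := by
  obtain ⟨Φ, hΦ, hF⟩ := hF
  obtain ⟨Θ, hΘ, hsubst⟩ := RecFunctional.oracle.exists_subst hΦ
  refine ⟨Θ, hΘ, fun p r hr m => ?_⟩
  calc Θ p m = Θ p (Nat.pair m.unpair.1 m.unpair.2) := by rw [Nat.pair_unpair]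
    _ = Φ (row p m.unpair.1) m.unpair.2 := hsubst p _ _ (fun _ => rfl) _
    _ = Part.some (row r m.unpair.1 m.unpair.2) := hF _ _ (mem_rowwise_iff.1 hr _) _
    _ = Part.some (r m) := by rw [row, Nat.pair_unpair]

/-! ### Strong Weihrauch reducibility -/

section Reducibility

variable {X Y Z W U V : Type*} [Represented X] [Represented Y] [Represented Z] [Represented W]
  [Represented U] [Represented V]

theorem StrongLE.trans {f : Problem X Y} {g : Problem Z W} {h : Problem U V}
    (hfg : StrongLE f g) (hgh : StrongLE g h) : StrongLE f h := by
  obtain ⟨H, K, hH, hK, hfg⟩ := hfg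
  obtain ⟨H', K', hH', hK', hgh⟩ := hgh
  refine ⟨H.comp H', K'.comp K, hH.comp hH', hK'.comp hK, fun G hG => ?_⟩
  simpa only [PFun.comp_assoc] using hfg _ (hgh G hG)

theorem StrongEquiv.symm {f : Problem X Y} {g : Problem Z W} (h : StrongEquiv f g) :
    StrongEquiv g f := ⟨h.2, h.1⟩

theorem StrongEquiv.trans {f : Problem X Y} {g : Problem Z W} {h : Problem U V}
    (hfg : StrongEquiv f g) (hgh : StrongEquiv g h) : StrongEquiv f h :=
  ⟨hfg.1.trans hgh.1, hgh.2.trans hfg.2⟩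

theorem exists_realizes_dom_subset (f : Problem X Y) :
    ∃ G, Realizes G f ∧ ∀ p, (G p).Dom → ∃ x, Represented.Names p x ∧ (f x).Nonempty := by
  have hsol (p : ℕ → ℕ) (h : ∃ x, Represented.Names p x ∧ (f x).Nonempty) :
      ∃ q, ∃ x, Represented.Names p x ∧ ∃ y ∈ f x, Represented.Names q y := by
    obtain ⟨x, hp, y, hy⟩ := h
    obtain ⟨q, hq⟩ := Represented.exists_name y
    exact ⟨q, x, hp, y, hy, hq⟩
  choose G hG using hsol
  refine ⟨fun p => ⟨_, G p⟩, fun p x hp hx => ?_, fun _ h => h⟩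
  obtain ⟨x', hp', hy⟩ := hG p ⟨x, hp, hx⟩
  exact ⟨_, ⟨⟨x, hp, hx⟩, rfl⟩, Represented.names_unique hp' hp ▸ hy⟩

theorem Realizes.exists_eq_some {G : (ℕ → ℕ) →. (ℕ → ℕ)} {f : Problem X Y} (hG : Realizes G f)
    {p q : ℕ → ℕ} {x : X} {y : Y} (hp : Represented.Names p x) (hy : y ∈ f x)
    (hq : Represented.Names q y) : ∃ G', Realizes G' f ∧ G' p = Part.some q := by
  classical
  let G' : (ℕ → ℕ) →. (ℕ → ℕ) := fun p' => if p' = p then Part.some q else G p'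
  have hself : G' p = Part.some q := if_pos rfl
  have hne (p' : ℕ → ℕ) (h : p' ≠ p) : G' p' = G p' := if_neg h
  refine ⟨G', fun p' x' hp' hx' => ?_, hself⟩
  obtain rfl | h := eq_or_ne p' p
  · rw [hself]
    exact ⟨q, Part.mem_some q, y, Represented.names_unique hp hp' ▸ hy, hq⟩
  · rw [hne p' h]
    exact hG p' x' hp' hx'

-- A realizer of `g` may be changed at one name, and its domain may be restricted to the names of
-- instances of `g`; so `K` must produce such names and `H` must accept every name of a solution.
theorem strongLE_iff {f : Problem X Y} {g : Problem Z W} :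
    StrongLE f g ↔ ∃ H K : (ℕ → ℕ) →. (ℕ → ℕ), IsComputable H ∧ IsComputable K ∧
      ∀ p x, Represented.Names p x → (f x).Nonempty →
        ∃ r ∈ K p, ∃ z, Represented.Names r z ∧ (g z).Nonempty ∧
          ∀ q, ∀ w ∈ g z, Represented.Names q w → ∃ s ∈ H q, ∃ y ∈ f x, Represented.Names s y := by
  refine exists₂_congr fun H K => and_congr_right fun _ => and_congr_right fun _ =>
    ⟨fun h p x hp hx => ?_, fun h G hG p x hp hx => ?_⟩
  · obtain ⟨G, hG, hdom⟩ := exists_realizes_dom_subset g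
    obtain ⟨s, hs, -⟩ := h G hG p x hp hx
    obtain ⟨q₀, hq₀, -⟩ := Part.mem_bind_iff.1 hs
    obtain ⟨r, hr, hq₀⟩ := Part.mem_bind_iff.1 hq₀
    obtain ⟨z, hz, hgz⟩ := hdom r (Part.dom_iff_mem.2 ⟨q₀, hq₀⟩)
    refine ⟨r, hr, z, hz, hgz, fun q w hw hq => ?_⟩
    obtain ⟨G', hG', hr'q⟩ := hG.exists_eq_some hz hw hq
    obtain ⟨s, hs, hy⟩ := h G' hG' p x hp hx
    obtain ⟨q', hq', hs⟩ := Part.mem_bind_iff.1 hs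
    obtain ⟨r', hr', hq'⟩ := Part.mem_bind_iff.1 hq'
    obtain rfl := Part.mem_unique hr' hr
    obtain rfl := Part.mem_some_iff.1 (hr'q ▸ hq')
    exact ⟨s, hs, hy⟩
  · obtain ⟨r, hr, z, hz, hgz, hout⟩ := h p x hp hx
    obtain ⟨q, hq, w, hw, hqw⟩ := hG r z hz hgz
    obtain ⟨s, hs, hy⟩ := hout q w hw hqw
    exact ⟨s, Part.mem_bind_iff.2 ⟨q, Part.mem_bind_iff.2 ⟨r, hr, hq⟩, hs⟩, hy⟩

theorem StrongLE.parallelization {f : Problem X Y} {g : Problem Z W} (h : StrongLE f g) :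
    StrongLE (parallelization f) (parallelization g) := by
  obtain ⟨H, K, hH, hK, h⟩ := strongLE_iff.1 h
  refine strongLE_iff.2 ⟨rowwise H, rowwise K, hH.rowwise, hK.rowwise, fun p x hp hx => ?_⟩
  obtain ⟨y, hy⟩ := hx
  choose r hr z hz hgz hout using fun i => h (row p i) (x i) (hp i) ⟨y i, hy i⟩
  choose w hw using hgz
  refine ⟨fun m => r m.unpair.1 m.unpair.2, mem_rowwise_iff.2 fun i => ?_, z, fun i => ?_,
    ⟨w, hw⟩, fun q w hw hq => ?_⟩
  · exact (row_merge r i).symm ▸ hr i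
  · exact (congrArg (Represented.Names · (z i)) (row_merge r i)).mpr (hz i)
  · choose s hs y hy hsy using fun i => hout i (row q i) (w i) (hw i) (hq i)
    refine ⟨fun m => s m.unpair.1 m.unpair.2, mem_rowwise_iff.2 fun i => ?_, y, hy, fun i => ?_⟩
    · exact (row_merge s i).symm ▸ hs i
    · exact (congrArg (Represented.Names · (y i)) (row_merge s i)).mpr (hsy i)

theorem StrongEquiv.parallelization {f : Problem X Y} {g : Problem Z W} (h : StrongEquiv f g) :
    StrongEquiv (parallelization f) (parallelization g) :=
  ⟨h.1.parallelization, h.2.parallelization⟩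

end Reducibility

/-! ### Computable maps -/

/-- The functional `F` is total computable; its second argument is the index of an entry of the
output sequence. -/
def TotalComputable (F : (ℕ → ℕ) → ℕ → ℕ) : Prop :=
  RecFunctional fun p n => Part.some (F p n)

theorem TotalComputable.reindex {q : ℕ → ℕ} (hq : Primrec q) :
    TotalComputable fun p n => p (q n) :=
  RecFunctional.oracle.comp_primrec hq

theorem TotalComputable.postcomp {F : (ℕ → ℕ) → ℕ → ℕ} (hF : TotalComputable F) {g : ℕ → ℕ → ℕ}
    (hg : Primrec₂ g) : TotalComputable fun p n => g n (F p n) :=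
  have hg' : Primrec fun m : ℕ => g m.unpair.1 m.unpair.2 :=
    hg.comp (primrec_unpair_fst Primrec.id) (primrec_unpair_snd Primrec.id)
  (RecFunctional.bind hF (.of_natPrimrec (Primrec.nat_iff.1 hg'))).of_eq fun _ _ => by simp

theorem TotalComputable.interleave {F G : (ℕ → ℕ) → ℕ → ℕ} (hF : TotalComputable F)
    (hG : TotalComputable G) :
    TotalComputable fun p n => if n % 2 = 0 then F p (n / 2) else G p (n / 2) := by
  have hhalf : Primrec fun n : ℕ => n / 2 := Primrec.nat_div.comp Primrec.id (Primrec.const 2)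
  have hpair : TotalComputable fun p n => Nat.pair (F p (n / 2)) (G p (n / 2)) :=
    ((RecFunctional.comp_primrec hF hhalf).pair (RecFunctional.comp_primrec hG hhalf)).of_eq
      fun _ _ => by simp [Seq.seq]
  have hselect : Primrec₂ fun n k : ℕ => if n % 2 = 0 then k.unpair.1 else k.unpair.2 :=
    Primrec.ite (Primrec.eq.comp (Primrec.nat_mod.comp Primrec.fst (Primrec.const 2))
      (Primrec.const 0)) (primrec_unpair_fst Primrec.snd) (primrec_unpair_snd Primrec.snd)
  exact (hpair.postcomp hselect).of_eq fun _ _ => by simp only [Nat.unpair_pair]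

-- The loop conses the answers onto a list one after the other, so that they come out reversed.
theorem rec_eq_encode_answers (p : ℕ → ℕ) (l : List ℕ) {k : ℕ} (hk : k ≤ l.length) :
    (Nat.rec (Part.some 0)
      (fun y ih => ih >>= fun i => Part.some (Nat.pair (p (l.getD y 0)) i + 1)) k : Part ℕ) =
      Part.some (Encodable.encode ((l.take k).map p).reverse) := by
  induction k with
  | zero => rfl
  | succ k ih =>
    simp only [ih (Nat.le_of_succ_le hk), List.take_succ_eq_append_getElem hk, List.map_append]
    simp [List.getElem?_eq_getElem hk, -List.map_take]

theorem totalComputable_encode_answers {q : ℕ → List ℕ} (hq : Primrec q) :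
    TotalComputable fun p n => Encodable.encode ((q n).map p).reverse := by
  have hget : Primrec fun m : ℕ => (q m.unpair.1).getD m.unpair.2.unpair.1 0 :=
    (Primrec.list_getD 0).comp (hq.comp (primrec_unpair_fst Primrec.id))
      (primrec_unpair_fst (primrec_unpair_snd Primrec.id))
  have hcons : Primrec₂ fun m k : ℕ => Nat.pair k m.unpair.2.unpair.2 + 1 :=
    Primrec.succ.comp (Primrec₂.natPair.comp Primrec.snd
      (primrec_unpair_snd (primrec_unpair_snd Primrec.fst)))
  have hlen : Primrec fun n => Nat.pair n (q n).length :=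
    Primrec₂.natPair.comp Primrec.id (Primrec.list_length.comp hq)
  refine ((RecFunctional.zero.prec ((TotalComputable.reindex hget).postcomp hcons)).comp_primrec
    hlen).of_eq fun p n => ?_
  simp only [Nat.unpair_pair]
  simpa only [List.take_length] using rec_eq_encode_answers p (q n) le_rfl

theorem totalComputable_answers {q : ℕ → List ℕ} {g : ℕ → List ℕ → ℕ} (hq : Primrec q)
    (hg : Primrec₂ g) : TotalComputable fun p n => g n ((q n).map p) := by
  have hpost : Primrec₂ fun n k : ℕ =>
      g n ((Encodable.decode (α := List ℕ) k).getD []).reverse :=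
    hg.comp Primrec.fst <| Primrec.list_reverse.comp <|
      Primrec.option_getD.comp (Primrec.decode.comp Primrec.snd) (Primrec.const [])
  exact ((totalComputable_encode_answers hq).postcomp hpost).of_eq fun _ _ => by
    simp only [Encodable.encodek, Option.getD_some, List.reverse_reverse]

/-- `p` is the characteristic function of `A`, through the coding of `α`. -/
def IsCharFun {α : Type*} [Encodable α] (p : ℕ → ℕ) (A : Set α) : Prop :=
  ∀ a, (a ∈ A → p (Encodable.encode a) = 1) ∧ (a ∉ A → p (Encodable.encode a) = 0)

theorem IsCharFun.eq_one_iff {α : Type*} [Encodable α] {p : ℕ → ℕ} {A : Set α}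
    (hp : IsCharFun p A) (a : α) : p (Encodable.encode a) = 1 ↔ a ∈ A :=
  ⟨fun h => by_contra fun ha => by simp [(hp a).2 ha] at h, (hp a).1⟩

theorem exists_totalComputable_isCharFun {α β : Type*} [Primcodable α] [Primcodable β]
    [Inhabited β] {P : β → Prop} {q : β → List α} (hP : PrimrecPred P) (hq : Primrec q) :
    ∃ F, TotalComputable F ∧
      ∀ p A, IsCharFun p A → IsCharFun (F p) {b | P b ∧ ∀ a ∈ q b, a ∈ A} := by
  classical
  let point (n : ℕ) : β := (Encodable.decode n).getD default
  have hpoint : Primrec point := Primrec.option_getD.comp Primrec.decode (Primrec.const default)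
  have hqueries : Primrec fun n => (q (point n)).map Encodable.encode :=
    Primrec.list_map (hq.comp hpoint) (Primrec.encode.comp Primrec.snd)
  have hones : PrimrecPred fun l : List ℕ => ∀ k ∈ l, k = 1 :=
    PrimrecPred.forall_mem_list (p := (· = 1)) (Primrec.eq.comp Primrec.id (Primrec.const 1))
  have hanswer : Primrec₂ fun (n : ℕ) (l : List ℕ) =>
      if P (point n) ∧ ∀ k ∈ l, k = 1 then 1 else 0 :=
    Primrec.ite ((hP.comp (hpoint.comp Primrec.fst)).and (hones.comp Primrec.snd))
      (Primrec.const 1) (Primrec.const 0)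
  refine ⟨_, totalComputable_answers hqueries hanswer, fun p A hp b => ?_⟩
  have hmem : (∀ k ∈ ((q b).map Encodable.encode).map p, k = 1) ↔ ∀ a ∈ q b, a ∈ A := by
    simp only [List.forall_mem_map, hp.eq_one_iff]
  have hb : point (Encodable.encode b) = b := by simp [point]
  simp only [hb, hmem]
  exact ⟨fun h => if_pos h, fun h => if_neg h⟩

section ComputableMap

variable {X Y Z W : Type*} [Represented X] [Represented Y] [Represented Z] [Represented W]

/-- A map of represented spaces that is tracked on names by a total computable functional. -/
def IsComputableMap (f : X → Y) : Prop :=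
  ∃ F, TotalComputable F ∧ ∀ p x, Represented.Names p x → Represented.Names (F p) (f x)

theorem isComputableMap_id : IsComputableMap (id : X → X) :=
  ⟨fun p => p, .oracle, fun _ _ h => h⟩

theorem IsComputableMap.comp_val {f : X → Y} (hf : IsComputableMap f) (P : X → Prop) :
    IsComputableMap fun x : {x // P x} => f x :=
  let ⟨F, hF, hnames⟩ := hf
  ⟨F, hF, fun p x => hnames p x⟩

theorem isComputableMap_fst : IsComputableMap (Prod.fst : X × Y → X) :=
  ⟨_, .reindex (Primrec.nat_mul.comp (Primrec.const 2) Primrec.id), fun _ _ h => h.1⟩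

theorem IsComputableMap.prodMk {f : X → Y} {g : X → Z} (hf : IsComputableMap f)
    (hg : IsComputableMap g) : IsComputableMap fun x => (f x, g x) := by
  obtain ⟨F, hF, hf⟩ := hf
  obtain ⟨G, hG, hg⟩ := hg
  refine ⟨_, hF.interleave hG, fun p x hp => ⟨?_, ?_⟩⟩
  · simpa using hf p x hp
  · have hmod (n : ℕ) : (2 * n + 1) % 2 ≠ 0 := by lia
    have hdiv (n : ℕ) : (2 * n + 1) / 2 = n := by lia
    simpa only [if_neg (hmod _), hdiv] using hg p x hp

theorem TotalComputable.isComputable {F : (ℕ → ℕ) → ℕ → ℕ} (hF : TotalComputable F) :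
    IsComputable (PFun.lift F) :=
  ⟨_, hF, fun _ _ hq _ => Part.mem_some_iff.1 hq ▸ rfl⟩

theorem StrongLE.of_isComputableMap {f : Problem X Y} {g : Problem Z W} {k : X → Z} {h : W → Y}
    (hk : IsComputableMap k) (hh : IsComputableMap h)
    (hdom : ∀ x, (f x).Nonempty → (g (k x)).Nonempty) (hsol : ∀ x, ∀ w ∈ g (k x), h w ∈ f x) :
    StrongLE f g := by
  obtain ⟨K, hK, hk⟩ := hk
  obtain ⟨H, hH, hh⟩ := hh
  exact strongLE_iff.2 ⟨_, _, hH.isComputable, hK.isComputable, fun p x hp hx =>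
    ⟨K p, Part.mem_some _, k x, hk p x hp, hdom x hx, fun q w hw hq =>
      ⟨H q, Part.mem_some _, h w, hsol x w hw, hh q w hq⟩⟩⟩

end ComputableMap

/-! ### Paths and perfect subtrees -/

theorem exists_path_of_extend {P : List ℕ → Prop} (h0 : P [])
    (hs : ∀ σ, P σ → ∃ a, P (σ ++ [a])) : ∃ f : ℕ → ℕ, ∀ n, P ((List.range n).map f) := by
  choose c hc using hs
  let s : ℕ → {σ // P σ} := fun n => n.rec ⟨[], h0⟩ fun _ σ => ⟨σ.1 ++ [c σ.1 σ.2], hc σ.1 σ.2⟩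
  refine ⟨fun n => c (s n).1 (s n).2, fun n => ?_⟩
  suffices h : (List.range n).map (fun n => c (s n).1 (s n).2) = (s n).1 from h ▸ (s n).2
  induction n with
  | zero => rfl
  | succ n ih =>
    rw [List.range_succ, List.map_append, ih]
    rfl

theorem IsPerfect.exists_append {S : Set (List ℕ)} (hP : IsPerfect S) (hS : IsTree S)
    {σ : List ℕ} (hσ : σ ∈ S) : ∃ a, σ ++ [a] ∈ S := by
  obtain ⟨_, h₁, τ, -, ⟨l, rfl⟩, hτ, hl, -⟩ := hP σ hσ
  cases l with
  | nil => exact absurd (by simpa using hτ) hl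
  | cons a l => exact ⟨a, hS _ h₁ _ ⟨l, by simp⟩⟩

theorem IsPerfect.of_exists_append {S : Set (List ℕ)}
    (h : ∀ σ ∈ S, ∃ a b, a ≠ b ∧ σ ++ [a] ∈ S ∧ σ ++ [b] ∈ S) : IsPerfect S := by
  intro σ hσ
  obtain ⟨a, b, hab, ha, hb⟩ := h σ hσ
  refine ⟨_, ha, _, hb, List.prefix_append _ _, List.prefix_append _ _, fun h => hab ?_,
    fun h => hab ?_⟩
  · simpa using h
  · simpa [eq_comm] using h

theorem IsPerfect.subset_perfectKernel {S T : Set (List ℕ)} (hP : IsPerfect S) (hT : IsTree T)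
    (hST : S ⊆ T) : S ⊆ perfectKernel T := by
  refine fun σ hσ => ⟨{τ | ∃ ρ ∈ S, τ <+: ρ}, ⟨?_, ?_, ?_⟩, σ, hσ, List.prefix_rfl⟩
  · rintro τ ⟨ρ, hρ, hτρ⟩
    exact hT ρ (hST hρ) τ hτρ
  · rintro τ ⟨ρ, hρ, hτρ⟩ τ' hτ'
    exact ⟨ρ, hρ, hτ'.trans hτρ⟩
  · rintro τ ⟨ρ, hρ, hτρ⟩
    obtain ⟨ρ₁, h₁, ρ₂, h₂, hρ₁, hρ₂, hinc⟩ := hP ρ hρ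
    exact ⟨ρ₁, ⟨ρ₁, h₁, List.prefix_rfl⟩, ρ₂, ⟨ρ₂, h₂, List.prefix_rfl⟩, hτρ.trans hρ₁,
      hτρ.trans hρ₂, hinc⟩

/-! ### Marking the nodes of a tree by leaves -/

section LeafMarked

variable {T : Set (List ℕ)} {σ ρ : List ℕ}

/-- The tree `T` with every entry increased by one and with a leaf `σ ⌢ 0` added above every
node `σ`, so that the leaves can be recognized by their last entry. -/
def leafMarked (T : Set (List ℕ)) : Set (List ℕ) :=
  {ρ | ∃ σ ∈ T, ρ = σ.map Nat.succ ∨ ρ = σ.map Nat.succ ++ [0]}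

theorem zero_notMem_map_succ (σ : List ℕ) : 0 ∉ σ.map Nat.succ := by simp

theorem map_succ_mem_leafMarked : σ.map Nat.succ ∈ leafMarked T ↔ σ ∈ T := by
  refine ⟨?_, fun h => ⟨σ, h, .inl rfl⟩⟩
  rintro ⟨τ, hτ, h | h⟩
  · exact List.map_injective_iff.2 Nat.succ_injective h ▸ hτ
  · exact absurd (h ▸ List.mem_append_right _ List.mem_cons_self) (zero_notMem_map_succ σ)

theorem exists_eq_map_succ_of_append_mem_leafMarked {a : ℕ} (h : ρ ++ [a] ∈ leafMarked T) :
    ∃ σ : List ℕ, ρ = σ.map Nat.succ := by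
  obtain ⟨σ, -, h | h⟩ := h
  · obtain ⟨τ, -, hτ⟩ := List.prefix_map_iff.1 (h ▸ List.prefix_append ρ [a])
    exact ⟨τ, hτ⟩
  · exact ⟨σ, (List.append_inj' h rfl).1⟩

theorem isTree_leafMarked (hT : IsTree T) : IsTree (leafMarked T) := by
  have hmap {σ ρ} (hσ : σ ∈ T) (hρ : ρ <+: σ.map Nat.succ) : ρ ∈ leafMarked T := by
    obtain ⟨τ, hτ, rfl⟩ := List.prefix_map_iff.1 hρ
    exact ⟨τ, hT σ hσ τ hτ, .inl rfl⟩
  rintro _ ⟨σ, hσ, rfl | rfl⟩ ρ hρ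
  · exact hmap hσ hρ
  · rcases List.prefix_concat_iff.1 hρ with rfl | hρ
    · exact ⟨σ, hσ, .inr rfl⟩
    · exact hmap hσ hρ

theorem mem_leaves_leafMarked :
    ρ ∈ leaves (leafMarked T) ↔ ∃ σ ∈ T, ρ = σ.map Nat.succ ++ [0] := by
  constructor
  · rintro ⟨⟨σ, hσ, rfl | rfl⟩, hleaf⟩
    · exact absurd (hleaf _ ⟨σ, hσ, .inr rfl⟩ (List.prefix_append _ _)) (by simp)
    · exact ⟨σ, hσ, rfl⟩
  · rintro ⟨σ, hσ, rfl⟩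
    have hnot (τ : List ℕ) : ¬ σ.map Nat.succ ++ [0] <+: τ.map Nat.succ := fun h =>
      zero_notMem_map_succ τ (h.subset (List.mem_append_right _ List.mem_cons_self))
    refine ⟨⟨σ, hσ, .inr rfl⟩, ?_⟩
    rintro _ ⟨τ, -, rfl | rfl⟩ hστ
    · exact absurd hστ (hnot τ)
    · exact ((List.prefix_concat_iff.1 hστ).resolve_right (hnot τ)).symm

theorem isWellFounded_leafMarked : IsWellFounded (leafMarked T) ↔ IsWellFounded T := by
  refine not_congr ⟨fun ⟨f, hf⟩ => ⟨fun n => (f n).pred, fun n => ?_⟩,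
    fun ⟨f, hf⟩ => ⟨fun n => (f n).succ, fun n => ?_⟩⟩
  · have hsucc := hf (n + 1)
    rw [List.range_succ, List.map_append] at hsucc
    obtain ⟨σ, hσ⟩ := exists_eq_map_succ_of_append_mem_leafMarked hsucc
    have hpred : (List.range n).map (fun n => (f n).pred) = σ := by
      calc _ = ((List.range n).map f).map Nat.pred := (List.map_map ..).symm
        _ = σ := by simp [hσ, Function.comp_def]
    exact hpred ▸ map_succ_mem_leafMarked.1 (hσ ▸ hf n)
  · have := map_succ_mem_leafMarked.2 (hf n)
    rwa [List.map_map] at this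

theorem map_succ_mem_perfectKernel_leafMarked (hT : IsTree T) :
    σ.map Nat.succ ∈ perfectKernel (leafMarked T) ↔ σ ∈ perfectKernel T := by
  have hprefix {σ τ : List ℕ} : σ.map Nat.succ <+: τ.map Nat.succ ↔ σ <+: τ :=
    List.prefix_map_iff_of_injective Nat.succ_injective
  constructor
  · rintro ⟨S, ⟨hST, hS, hP⟩, hσ⟩
    have hmap (ρ) (hρ : ρ ∈ S) : ∃ τ : List ℕ, ρ = τ.map Nat.succ :=
      let ⟨_, ha⟩ := hP.exists_append hS hρ
      exists_eq_map_succ_of_append_mem_leafMarked (hST ha)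
    have hpre : IsPerfect {τ | τ.map Nat.succ ∈ S} := by
      intro τ hτ
      obtain ⟨_, h₁, _, h₂, h⟩ := hP _ hτ
      obtain ⟨τ₁, rfl⟩ := hmap _ h₁
      obtain ⟨τ₂, rfl⟩ := hmap _ h₂
      exact ⟨τ₁, h₁, τ₂, h₂, by simpa only [hprefix] using h⟩
    exact hpre.subset_perfectKernel hT (fun τ hτ => map_succ_mem_leafMarked.1 (hST hτ)) hσ
  · rintro ⟨S, ⟨hST, -, hP⟩, hσ⟩
    have himage : IsPerfect (List.map Nat.succ '' S) := by
      rintro _ ⟨τ, hτ, rfl⟩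
      obtain ⟨τ₁, h₁, τ₂, h₂, h⟩ := hP _ hτ
      exact ⟨_, ⟨τ₁, h₁, rfl⟩, _, ⟨τ₂, h₂, rfl⟩, by simpa only [hprefix] using h⟩
    refine himage.subset_perfectKernel (isTree_leafMarked hT) ?_ ⟨σ, hσ, rfl⟩
    rintro _ ⟨τ, hτ, rfl⟩
    exact map_succ_mem_leafMarked.2 (hST hτ)

end LeafMarked

/-! ### Thickening and joining a sequence of trees -/

/-- The first components of the entries of a sequence over `ℕ × ℕ`. -/
def firsts (σ : List ℕ) : List ℕ := σ.map fun a => a.unpair.1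

/-- The trees `T i × ℕ^{<ℕ}` joined above the nodes `[i]`; the second factor turns a path into a
perfect tree. -/
def thickJoin (T : ℕ → Set (List ℕ)) : Set (List ℕ) :=
  {ρ | ρ = [] ∨ ∃ i σ, ρ = i :: σ ∧ firsts σ ∈ T i}

section ThickJoin

variable {T : ℕ → Set (List ℕ)} {i : ℕ} {σ : List ℕ}

theorem cons_mem_thickJoin : i :: σ ∈ thickJoin T ↔ firsts σ ∈ T i := by
  simp [thickJoin]

theorem isTree_thickJoin (hT : ∀ i, IsTree (T i)) : IsTree (thickJoin T) := by
  rintro σ hσ (_ | ⟨i, τ⟩) hτ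
  · exact .inl rfl
  · obtain ⟨l, rfl⟩ := hτ
    rw [List.cons_append, cons_mem_thickJoin] at hσ
    exact cons_mem_thickJoin.2 (hT i _ hσ _ ((List.prefix_append _ _).map _))

theorem firsts_concat_pair (σ : List ℕ) (a b : ℕ) :
    firsts (σ ++ [Nat.pair a b]) = firsts σ ++ [a] := by
  simp [firsts]

theorem singleton_mem_perfectKernel_thickJoin (hT : ∀ i, IsTree (T i)) :
    [i] ∈ perfectKernel (thickJoin T) ↔ ¬ IsWellFounded (T i) := by
  rw [IsWellFounded, not_not]
  constructor
  · rintro ⟨S, ⟨hST, hS, hP⟩, hi⟩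
    obtain ⟨f, hf⟩ := exists_path_of_extend (P := fun σ => i :: σ ∈ S) hi
      fun σ hσ => hP.exists_append hS hσ
    refine ⟨fun n => (f n).unpair.1, fun n => ?_⟩
    have := cons_mem_thickJoin.1 (hST (hf n))
    rwa [firsts, List.map_map] at this
  · rintro ⟨f, hf⟩
    let S : Set (List ℕ) := {ρ | ∃ σ n, ρ = i :: σ ∧ firsts σ = (List.range n).map f}
    have happend {σ n} (hσ : firsts σ = (List.range n).map f) (b : ℕ) :
        i :: σ ++ [Nat.pair (f n) b] ∈ S :=
      ⟨σ ++ [Nat.pair (f n) b], n + 1, rfl, by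
        rw [firsts_concat_pair, hσ, List.range_succ, List.map_append, List.map_singleton]⟩
    have hP : IsPerfect S := by
      refine .of_exists_append ?_
      rintro _ ⟨σ, n, rfl, hσ⟩
      exact ⟨_, _, by simp, happend hσ 0, happend hσ 1⟩
    refine hP.subset_perfectKernel (isTree_thickJoin hT) ?_ ⟨[], 0, rfl, rfl⟩
    rintro _ ⟨σ, n, rfl, hσ⟩
    exact cons_mem_thickJoin.2 (hσ ▸ hf n)

end ThickJoin

/-! ### Embeddings of the full binary tree -/

/-- The full binary tree is enumerated level by level, the children of `j` being `2 * j + 1` and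
`2 * j + 2`. The labels of the children of `j` under `t` are incompatible extensions of the label
of `j`. -/
def Splits (t : ℕ → List ℕ) (j : ℕ) : Prop :=
  t j <+: t (2 * j + 1) ∧ t j <+: t (2 * j + 2) ∧
    ¬ t (2 * j + 1) <+: t (2 * j + 2) ∧ ¬ t (2 * j + 2) <+: t (2 * j + 1)

theorem Splits.congr {t t' : ℕ → List ℕ} {j : ℕ} (ht : Splits t j)
    (h : ∀ i < 2 * j + 3, t i = t' i) : Splits t' j := by
  unfold Splits at *
  rwa [← h j (by lia), ← h (2 * j + 1) (by lia), ← h (2 * j + 2) (by lia)]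

/-- The labelling of the full binary tree with root label `a` in which `c₁` and `c₂` give the
labels of the children. -/
def binaryLabel {α : Type*} (c₁ c₂ : α → α) (a : α) : ℕ → α
  | 0 => a
  | n + 1 =>
    if n % 2 = 0 then c₁ (binaryLabel c₁ c₂ a (n / 2)) else c₂ (binaryLabel c₁ c₂ a (n / 2))

section BinaryLabel

variable {α : Type*} (c₁ c₂ : α → α) (a : α)

theorem binaryLabel_zero : binaryLabel c₁ c₂ a 0 = a := by
  rw [binaryLabel]

theorem binaryLabel_two_mul_add_one (j : ℕ) :
    binaryLabel c₁ c₂ a (2 * j + 1) = c₁ (binaryLabel c₁ c₂ a j) := by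
  rw [binaryLabel, if_pos (by lia), Nat.mul_div_cancel_left j two_pos]

theorem binaryLabel_two_mul_add_two (j : ℕ) :
    binaryLabel c₁ c₂ a (2 * j + 2) = c₂ (binaryLabel c₁ c₂ a j) := by
  rw [binaryLabel, if_neg (by lia), show (2 * j + 1) / 2 = j by lia]

end BinaryLabel

section EmbeddingTree

variable {T : Set (List ℕ)} {σ : List ℕ}

theorem mem_perfectKernel_iff_exists_splits (hT : IsTree T) :
    σ ∈ perfectKernel T ↔ ∃ t : ℕ → List ℕ, t 0 = σ ∧ ∀ j, t j ∈ T ∧ Splits t j := by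
  constructor
  · rintro ⟨S, ⟨hST, -, hP⟩, hσ⟩
    have hchildren (τ : S) :
        ∃ τ₁ τ₂ : S, τ.1 <+: τ₁ ∧ τ.1 <+: τ₂ ∧ ¬ τ₁.1 <+: τ₂ ∧ ¬ τ₂.1 <+: τ₁ :=
      let ⟨τ₁, h₁, τ₂, h₂, h⟩ := hP τ τ.2
      ⟨⟨τ₁, h₁⟩, ⟨τ₂, h₂⟩, h⟩
    choose c₁ c₂ hc using hchildren
    let t := binaryLabel c₁ c₂ ⟨σ, hσ⟩
    refine ⟨fun j => t j, congrArg Subtype.val (binaryLabel_zero c₁ c₂ _),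
      fun j => ⟨hST (t j).2, ?_⟩⟩
    simpa only [Splits, t, binaryLabel_two_mul_add_one, binaryLabel_two_mul_add_two] using hc (t j)
  · rintro ⟨t, rfl, ht⟩
    have hP : IsPerfect (Set.range t) := by
      rintro _ ⟨j, rfl⟩
      exact ⟨_, ⟨2 * j + 1, rfl⟩, _, ⟨2 * j + 2, rfl⟩, (ht j).2⟩
    exact hP.subset_perfectKernel hT (Set.range_subset_iff.2 fun j => (ht j).1) ⟨0, rfl⟩

/-- The label of `i` in the finite labelling of the full binary tree that is coded by `τ`. The
default label `σ` makes the empty labelling agree with `σ` at the root. -/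
def label (σ τ : List ℕ) (i : ℕ) : List ℕ :=
  Denumerable.ofNat (List ℕ) (τ.getD i (Encodable.encode σ))

theorem label_nil (σ : List ℕ) (i : ℕ) : label σ [] i = σ := by
  simp [label]

theorem label_append {τ : List ℕ} {i : ℕ} (hi : i < τ.length) (l : List ℕ) :
    label σ (τ ++ l) i = label σ τ i := by
  rw [label, List.getD_append _ _ _ _ hi, label]

theorem label_map_range (f : ℕ → ℕ) {n i : ℕ} (hi : i < n) :
    label σ ((List.range n).map f) i = Denumerable.ofNat (List ℕ) (f i) := by
  simp [label, hi]

/-- The finite sequences of codes of labels in `T` that are initial segments of a labelling of the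
full binary tree with root label `σ` that splits everywhere. -/
def embeddingTree (T : Set (List ℕ)) (σ : List ℕ) : Set (List ℕ) :=
  {τ | label σ τ 0 = σ ∧ (∀ a ∈ τ, Denumerable.ofNat (List ℕ) a ∈ T) ∧
    ∀ j, 2 * j + 2 < τ.length → Splits (label σ τ) j}

theorem isTree_embeddingTree (T : Set (List ℕ)) (σ : List ℕ) : IsTree (embeddingTree T σ) := by
  rintro _ ⟨hroot, hmem, hsplits⟩ τ ⟨l, rfl⟩
  refine ⟨?_, fun a ha => hmem a (List.mem_append_left l ha), fun j hj => ?_⟩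
  · obtain rfl | hτ := eq_or_ne τ []
    · exact label_nil σ 0
    · rwa [label_append (List.length_pos_of_ne_nil hτ)] at hroot
  · exact (hsplits j (by rw [List.length_append]; lia)).congr fun i hi => label_append (by lia) l

theorem exists_path_embeddingTree_iff :
    (∃ f : ℕ → ℕ, ∀ n, (List.range n).map f ∈ embeddingTree T σ) ↔
      ∃ t : ℕ → List ℕ, t 0 = σ ∧ ∀ j, t j ∈ T ∧ Splits t j := by
  constructor
  · rintro ⟨f, hf⟩
    refine ⟨fun j => Denumerable.ofNat (List ℕ) (f j), ?_, fun j => ⟨?_, ?_⟩⟩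
    · exact (label_map_range f one_pos).symm.trans (hf 1).1
    · exact (hf (j + 1)).2.1 _ (List.mem_map.2 ⟨j, List.self_mem_range_succ, rfl⟩)
    · exact ((hf (2 * j + 3)).2.2 j (by simp)).congr fun i => label_map_range f
  · rintro ⟨t, rfl, ht⟩
    refine ⟨fun j => Encodable.encode (t j), fun n => ⟨?_, fun a ha => ?_, fun j hj => ?_⟩⟩
    · obtain rfl | hn := n.eq_zero_or_pos
      · exact label_nil _ 0
      · rw [label_map_range _ hn, Denumerable.ofNat_encode]
    · obtain ⟨j, -, rfl⟩ := List.mem_map.1 ha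
      simpa only [Denumerable.ofNat_encode] using (ht j).1
    · rw [List.length_map, List.length_range] at hj
      refine (ht j).2.congr fun i hi => ?_
      rw [label_map_range _ (by lia), Denumerable.ofNat_encode]

theorem isWellFounded_embeddingTree (hT : IsTree T) :
    IsWellFounded (embeddingTree T σ) ↔ σ ∉ perfectKernel T := by
  rw [mem_perfectKernel_iff_exists_splits hT, IsWellFounded, exists_path_embeddingTree_iff]

end EmbeddingTree

/-! ### Computability of the constructions -/

theorem primrec_ofNat_list : Primrec (Denumerable.ofNat (List ℕ)) :=
  (Primrec.option_getD.comp Primrec.decode (Primrec.const [])).of_eq fun n => by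
    rw [Denumerable.decode_eq_ofNat, Option.getD_some]

theorem names_sequence_iff {p : ℕ → ℕ} {A : ℕ → Set (List ℕ)} :
    Represented.Names p A ↔ IsCharFun p {x : ℕ × List ℕ | x.2 ∈ A x.1} :=
  ⟨fun h x => h x.1 x.2, fun h i σ => h (i, σ)⟩

theorem isComputableMap_preimage_map_succ :
    IsComputableMap fun A : Set (List ℕ) => {σ : List ℕ | σ.map Nat.succ ∈ A} := by
  have hquery : Primrec fun n =>
      Encodable.encode ((Denumerable.ofNat (List ℕ) n).map Nat.succ) :=
    Primrec.encode.comp (Primrec.list_map primrec_ofNat_list (Primrec.succ.comp₂ .right))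
  refine ⟨_, .reindex hquery, fun p A hp σ => ?_⟩
  rw [Denumerable.ofNat_encode]
  exact hp (σ.map Nat.succ)

/-- The node of `T` that an element of `leafMarked T` stems from. -/
def unmark (ρ : List ℕ) : List ℕ := (ρ.filter (· ≠ 0)).map Nat.pred

theorem unmark_map_succ (σ : List ℕ) : unmark (σ.map Nat.succ) = σ := by
  simp [unmark, List.filter_map, Function.comp_def]

theorem unmark_map_succ_append_zero (σ : List ℕ) : unmark (σ.map Nat.succ ++ [0]) = σ := by
  simp [unmark, List.filter_map, Function.comp_def]

theorem mem_leafMarked_iff_unmark {T : Set (List ℕ)} {ρ : List ℕ} : ρ ∈ leafMarked T ↔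
    (ρ = (unmark ρ).map Nat.succ ∨ ρ = (unmark ρ).map Nat.succ ++ [0]) ∧ unmark ρ ∈ T := by
  refine ⟨?_, fun h => ⟨unmark ρ, h.2, h.1⟩⟩
  rintro ⟨σ, hσ, rfl | rfl⟩
  · exact (unmark_map_succ σ).symm ▸ ⟨.inl rfl, hσ⟩
  · exact (unmark_map_succ_append_zero σ).symm ▸ ⟨.inr rfl, hσ⟩

theorem mem_leaves_leafMarked_iff_unmark {T : Set (List ℕ)} {ρ : List ℕ} :
    ρ ∈ leaves (leafMarked T) ↔ ρ = (unmark ρ).map Nat.succ ++ [0] ∧ unmark ρ ∈ T := by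
  refine mem_leaves_leafMarked.trans ⟨?_, fun h => ⟨unmark ρ, h.2, h.1⟩⟩
  rintro ⟨σ, hσ, rfl⟩
  exact (unmark_map_succ_append_zero σ).symm ▸ ⟨rfl, hσ⟩

/-- The tree `leafMarked T` together with its leaves. -/
def leafMarkedTree (T : Tree) : LeafTree :=
  ⟨(⟨leafMarked T.1, isTree_leafMarked T.2⟩, leaves (leafMarked T.1)), rfl⟩

theorem isComputableMap_leafMarkedTree : IsComputableMap leafMarkedTree := by
  have hunmark : Primrec unmark :=
    Primrec.list_map (Primrec.listFilter (p := (· ≠ 0))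
      (PrimrecPred.not (Primrec.eq.comp Primrec.id (Primrec.const 0)))) (Primrec.pred.comp₂ .right)
  have hquery : Primrec fun ρ => [unmark ρ] := Primrec.list_cons.comp hunmark (Primrec.const [])
  have hsucc : Primrec fun ρ => (unmark ρ).map Nat.succ :=
    Primrec.list_map hunmark (Primrec.succ.comp₂ .right)
  have hleaf : PrimrecPred fun ρ => ρ = (unmark ρ).map Nat.succ ++ [0] :=
    Primrec.eq.comp Primrec.id (Primrec.list_append.comp hsucc (Primrec.const [0]))
  obtain ⟨F, hF, hFchar⟩ :=
    exists_totalComputable_isCharFun ((Primrec.eq.comp Primrec.id hsucc).or hleaf) hquery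
  obtain ⟨G, hG, hGchar⟩ := exists_totalComputable_isCharFun hleaf hquery
  have htree : IsComputableMap fun T : Tree => (leafMarkedTree T).1.1 := by
    refine ⟨F, hF, fun p T hp => ?_⟩
    have := hFchar p T.1 hp
    simp only [id_eq, List.forall_mem_singleton, ← mem_leafMarked_iff_unmark] at this
    exact this
  have hleaves : IsComputableMap fun T : Tree => (leafMarkedTree T).1.2 := by
    refine ⟨G, hG, fun p T hp => ?_⟩
    have := hGchar p T.1 hp
    simp only [List.forall_mem_singleton, ← mem_leaves_leafMarked_iff_unmark] at this
    exact this
  exact htree.prodMk hleaves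

theorem isComputableMap_thickJoin : IsComputableMap fun T : ℕ → Tree =>
    (⟨thickJoin fun i => (T i).1, isTree_thickJoin fun i => (T i).2⟩ : Tree) := by
  have hfirsts : Primrec firsts :=
    Primrec.list_map Primrec.id (primrec_unpair_fst Primrec.snd)
  let query : List ℕ → List (ℕ × List ℕ) := fun ρ =>
    ρ.casesOn [] fun i σ => [(i, firsts σ)]
  have hcons : Primrec₂ fun (_ : List ℕ) (x : ℕ × List ℕ) => [(x.1, firsts x.2)] :=
    Primrec.list_cons.comp ((Primrec.fst.comp Primrec.snd).pair
      (hfirsts.comp (Primrec.snd.comp Primrec.snd))) (Primrec.const [])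
  have hquery : Primrec query := Primrec.list_casesOn Primrec.id (Primrec.const []) hcons
  have htrue : PrimrecPred fun _ : List ℕ => True := ⟨inferInstance, Primrec.const true⟩
  obtain ⟨F, hF, hchar⟩ := exists_totalComputable_isCharFun htrue hquery
  refine ⟨F, hF, fun p T hp => ?_⟩
  have hmem : {ρ | True ∧ ∀ x ∈ query ρ, x.2 ∈ (T x.1).1} = thickJoin fun i => (T i).1 := by
    ext (_ | ⟨i, σ⟩) <;> simp [query, thickJoin]
  exact (congrArg (IsCharFun (F p)) hmem).mp
    (hchar p _ (names_sequence_iff (A := fun i => (T i).1).1 hp))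

theorem primrecRel_isPrefix : PrimrecRel fun σ τ : List ℕ => σ <+: τ :=
  (Primrec.eq.comp Primrec.fst
    (Primrec.list_take.comp (Primrec.list_length.comp Primrec.fst) Primrec.snd)).of_eq
    fun _ => List.prefix_iff_eq_take.symm

section

variable {α : Type*} [Primcodable α] {σ τ : α → List ℕ} {i : α → ℕ}

theorem primrec_label (hσ : Primrec σ) (hτ : Primrec τ) (hi : Primrec i) :
    Primrec fun a => label (σ a) (τ a) (i a) :=
  primrec_ofNat_list.comp <| (Primrec.option_getD.comp (Primrec.list_getElem?.comp hτ hi)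
    (Primrec.encode.comp hσ)).of_eq fun _ => List.getD_eq_getElem?_getD.symm

theorem primrecPred_splits_label (hσ : Primrec σ) (hτ : Primrec τ) (hi : Primrec i) :
    PrimrecPred fun a => Splits (label (σ a) (τ a)) (i a) := by
  have hdouble : Primrec fun a => 2 * i a := Primrec.nat_mul.comp (Primrec.const 2) hi
  have hparent := primrec_label hσ hτ hi
  have hleft := primrec_label hσ hτ (Primrec.nat_add.comp hdouble (Primrec.const 1))
  have hright := primrec_label hσ hτ (Primrec.nat_add.comp hdouble (Primrec.const 2))
  exact (primrecRel_isPrefix.comp hparent hleft).and <|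
    (primrecRel_isPrefix.comp hparent hright).and <|
    (primrecRel_isPrefix.comp hleft hright).not.and (primrecRel_isPrefix.comp hright hleft).not

end

theorem primrecPred_splits_below_length : PrimrecPred fun x : ℕ × List ℕ =>
    ∀ j < x.2.length, 2 * j + 2 < x.2.length →
      Splits (label (Denumerable.ofNat (List ℕ) x.1) x.2) j := by
  have hσ : Primrec fun y : ℕ × ℕ × List ℕ => Denumerable.ofNat (List ℕ) y.2.1 :=
    primrec_ofNat_list.comp (Primrec.fst.comp Primrec.snd)
  have hτ : Primrec fun y : ℕ × ℕ × List ℕ => y.2.2 := Primrec.snd.comp Primrec.snd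
  have hchild : Primrec fun y : ℕ × ℕ × List ℕ => 2 * y.1 + 2 :=
    Primrec.nat_add.comp (Primrec.nat_mul.comp (Primrec.const 2) Primrec.fst) (Primrec.const 2)
  have hsplits : PrimrecRel fun (j : ℕ) (x : ℕ × List ℕ) => 2 * j + 2 < x.2.length →
      Splits (label (Denumerable.ofNat (List ℕ) x.1) x.2) j :=
    ((Primrec.nat_lt.comp hchild (Primrec.list_length.comp hτ)).not.or
      (primrecPred_splits_label hσ hτ Primrec.fst)).of_eq fun _ => imp_iff_not_or.symm
  exact (hsplits.forall_mem_list.comp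
    (Primrec.list_range.comp (Primrec.list_length.comp Primrec.snd)) Primrec.id).of_eq
    fun _ => by simp only [List.mem_range, id_eq]

theorem isComputableMap_embeddingTree : IsComputableMap fun (T : Tree) (n : ℕ) =>
    (⟨embeddingTree T.1 (Denumerable.ofNat (List ℕ) n), isTree_embeddingTree _ _⟩ : Tree) := by
  have hσ : Primrec fun x : ℕ × List ℕ => Denumerable.ofNat (List ℕ) x.1 :=
    primrec_ofNat_list.comp Primrec.fst
  have hroot : PrimrecPred fun x : ℕ × List ℕ => label (Denumerable.ofNat (List ℕ) x.1) x.2 0 =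
      Denumerable.ofNat (List ℕ) x.1 :=
    Primrec.eq.comp (primrec_label hσ Primrec.snd (Primrec.const 0)) hσ
  have hquery : Primrec fun x : ℕ × List ℕ => x.2.map (Denumerable.ofNat (List ℕ)) :=
    Primrec.list_map Primrec.snd (primrec_ofNat_list.comp Primrec.snd)
  obtain ⟨F, hF, hchar⟩ :=
    exists_totalComputable_isCharFun (hroot.and primrecPred_splits_below_length) hquery
  refine ⟨F, hF, fun p T hp => (names_sequence_iff (A := fun n =>
    embeddingTree T.1 (Denumerable.ofNat (List ℕ) n))).2 ?_⟩
  refine (congrArg (IsCharFun (F p)) (Set.ext fun ⟨n, τ⟩ => ?_)).mp (hchar p T.1 hp)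
  have hlt : (∀ j < τ.length, 2 * j + 2 < τ.length →
      Splits (label (Denumerable.ofNat (List ℕ) n) τ) j) ↔
      ∀ j, 2 * j + 2 < τ.length → Splits (label (Denumerable.ofNat (List ℕ) n) τ) j :=
    forall_congr' fun j => ⟨fun h hj => h (by lia) hj, fun h _ => h⟩
  simp only [embeddingTree, Set.mem_ofPred_eq, List.forall_mem_map, hlt, and_assoc]
  rw [and_comm (a := ∀ j, _)]

/-! ### The reductions -/

theorem nonempty_WF (T : Tree) : (WF T).Nonempty := by
  by_cases h : IsWellFounded T.1
  · exact ⟨1, .inl ⟨h, rfl⟩⟩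
  · exact ⟨0, .inr ⟨h, rfl⟩⟩

theorem nonempty_parallelization_WF (T : ℕ → Tree) : (parallelization WF T).Nonempty :=
  ⟨_, fun i => (nonempty_WF (T i)).some_mem⟩

theorem eq_zero_iff_of_mem_WF {T : Tree} {n : ℕ} (hn : n ∈ WF T) :
    n = 0 ↔ ¬ IsWellFounded T.1 := by
  rcases hn with ⟨h, rfl⟩ | ⟨h, rfl⟩ <;> simp [h]

theorem WFL_leafMarkedTree (T : Tree) : WFL (leafMarkedTree T) = WF T :=
  Set.ext fun n => by simp only [WFL, WF, leafMarkedTree, isWellFounded_leafMarked]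

theorem strongEquiv_WF_WFL : StrongEquiv WF WFL :=
  ⟨.of_isComputableMap isComputableMap_leafMarkedTree isComputableMap_id
      (fun T h => (WFL_leafMarkedTree T).symm ▸ h) (fun T _ h => WFL_leafMarkedTree T ▸ h),
    .of_isComputableMap (isComputableMap_fst.comp_val _) isComputableMap_id
      (fun _ h => h) fun _ _ h => h⟩

theorem strongEquiv_PK_PKL : StrongEquiv PK PKL := by
  refine ⟨.of_isComputableMap isComputableMap_leafMarkedTree isComputableMap_preimage_map_succ
      (fun _ _ => Set.singleton_nonempty _) ?_,
    .of_isComputableMap (isComputableMap_fst.comp_val _) isComputableMap_id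
      (fun _ h => h) fun _ _ h => h⟩
  rintro T _ rfl
  exact Set.ext fun σ => map_succ_mem_perfectKernel_leafMarked T.2

open Classical in
theorem isComputableMap_ite_singleton_mem :
    IsComputableMap fun (A : Set (List ℕ)) (i : ℕ) => if [i] ∈ A then 0 else 1 := by
  have hquery : Primrec fun n : ℕ => Encodable.encode [n.unpair.1] :=
    Primrec.encode.comp (Primrec.list_cons.comp (primrec_unpair_fst Primrec.id) (Primrec.const []))
  have hsub : Primrec₂ fun _ k : ℕ => 1 - k := Primrec.nat_sub.comp (Primrec.const 1) Primrec.snd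
  refine ⟨_, (TotalComputable.reindex hquery).postcomp hsub, fun p A hp i => ?_⟩
  change 1 - p (Encodable.encode [(Nat.pair i 0).unpair.1]) = if [i] ∈ A then 0 else 1
  rw [Nat.unpair_pair]
  by_cases h : [i] ∈ A
  · rw [(hp [i]).1 h, if_pos h]
  · rw [(hp [i]).2 h, if_neg h]

theorem isComputableMap_setOf_eq_zero :
    IsComputableMap fun w : ℕ → ℕ => {σ : List ℕ | w (Encodable.encode σ) = 0} := by
  have hquery : Primrec fun n => Nat.pair n 0 :=
    Primrec₂.natPair.comp Primrec.id (Primrec.const 0)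
  have hsub : Primrec₂ fun _ k : ℕ => 1 - k := Primrec.nat_sub.comp (Primrec.const 1) Primrec.snd
  refine ⟨_, (TotalComputable.reindex hquery).postcomp hsub, fun p w hp σ => ?_⟩
  have hσ : p (Nat.pair (Encodable.encode σ) 0) = w (Encodable.encode σ) := hp _
  rw [hσ, Set.mem_ofPred_eq]
  lia

theorem parallelization_WF_strongLE_PK : StrongLE (parallelization WF) PK := by
  classical
  refine .of_isComputableMap isComputableMap_thickJoin isComputableMap_ite_singleton_mem
    (fun _ _ => Set.singleton_nonempty _) ?_
  rintro T _ rfl i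
  simp only [singleton_mem_perfectKernel_thickJoin fun i => (T i).2]
  by_cases h : IsWellFounded (T i).1
  · exact .inl ⟨h, if_neg (not_not.2 h)⟩
  · exact .inr ⟨h, if_pos h⟩

theorem PK_strongLE_parallelization_WF : StrongLE PK (parallelization WF) := by
  refine .of_isComputableMap isComputableMap_embeddingTree isComputableMap_setOf_eq_zero
    (fun _ _ => nonempty_parallelization_WF _) fun T w hw => Set.ext fun σ => ?_
  rw [Set.mem_ofPred_eq, eq_zero_iff_of_mem_WF (hw _)]
  simp only [Denumerable.ofNat_encode, isWellFounded_embeddingTree T.2, not_not]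

theorem strongEquiv_parallelization_WF_PK : StrongEquiv (parallelization WF) PK :=
  ⟨parallelization_WF_strongLE_PK, PK_strongLE_parallelization_WF⟩

end TreeWeihrauch

open TreeWeihrauch in
theorem theorem7 :
    StrongEquiv WF WFL ∧
    StrongEquiv (parallelization WF) (parallelization WFL) ∧
    StrongEquiv (parallelization WF) PK ∧
    StrongEquiv (parallelization WF) PKL ∧
    StrongEquiv (parallelization WFL) PK ∧
    StrongEquiv (parallelization WFL) PKL ∧
    StrongEquiv PK PKL := by
  have hWL : StrongEquiv WF WFL := strongEquiv_WF_WFL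
  have hWF : StrongEquiv (parallelization WF) (parallelization WFL) := hWL.parallelization
  have hPK : StrongEquiv (parallelization WF) PK := strongEquiv_parallelization_WF_PK
  have hL : StrongEquiv PK PKL := strongEquiv_PK_PKL
  exact ⟨hWL, hWF, hPK, hPK.trans hL, hWF.symm.trans hPK, hWF.symm.trans (hPK.trans hL), hL⟩
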